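/- Let $\mathcal G$ be a finite, compact, connected metric graph: finitely many edges $e$, each a compact interval of positive finite length, glued together at their endpoints along an equivalence relation on the set of endpoints whose classes are the vertices (loops, multiple edges and vertices of degree two are allowed). Let $H^1(\mathcal G)$ be the space of functions on $\mathcal G$ that are continuous and belong to $H^1(e)$ on every edge $e$; for a set $\mathcal V_D$ of vertices let $H^1_0(\mathcal G;\mathcal V_D)=\{f\in H^1(\mathcal G): f=0 \text{ on } \mathcal V_D\}$, and let $a(f,g)=\int_{\mathcal G} f'\,\overline{g'}\,dx$. Denote by $\mu_k(\mathcal G)$ the $k$-th eigenvalue, in increasing order and counted with multiplicity ($k\ge 1$), of the Laplacian with natural (continuity and Kirchhoff) vertex conditions, i.e. of the operator on $L^2(\mathcal G)$ associated with the form $a$ on $H^1(\mathcal G)$; and by $\lambda_1(\mathcal G;\mathcal V_D)$ the lowest eigenvalue of the Laplacian with Dirichlet conditions on $\mathcal V_D$ and natural conditions at all other vertices, i.e. of the operator associated with $a$ on $H^1_0(\mathcal G;\mathcal V_D)$. A cut of $\mathcal G$ is a metric graph obtained by first inserting finitely many dummy vertices of degree two in the interiors of edges of $\mathcal G$, and then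 replacing each vertex (a set of endpoints of edges) by the parts of a partition of that set; a vertex is cut nontrivially if there are at least two parts. If a cut has exactly $k$ connected components $\mathcal G_1,\dots,\mathcal G_k$ (the clusters), then $\mathcal P=\{\mathcal G_1,\dots,\mathcal G_k\}$ is called an exhaustive $k$-partition of $\mathcal G$. Let $\Omega_i\subset\mathcal G$ be the union of the edges of $\mathcal G_i$, and let $\mathcal V_D(\mathcal G_i)$ be the set of those vertices of $\mathcal G_i$ that arise from nontrivially cut vertices of $\mathcal G$. The partition is called rigid if the set of nontrivially cut vertices equals $\bigcup_{i}\partial\Omega_i$, where $\partial\Omega_i$ is the topological boundary of $\Omega_i$ in $\mathcal G$. Let $\mathfrak R_k(\mathcal G)$ be the set of all exhaustive rigid $k$-partitions of $\mathcal G$ and $$\mathcal L^D_{k,\infty}(\mathcal G)=\inf_{\mathcal P\in\mathfrak R_k(\mathcal G)}\ \max_{1\le i\le k}\lambda_1(\mathcal G_i;\mathcal V_D(\mathcal G_i)).$$ Then for every $k\ge 1$, $$\mu_k(\mathcal G)\le \mathcal L^D_{k,\infty}(\mathcal G).$$ -/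

import Mathlib

open MeasureTheory Set

/-- A finite compact metric graph with edge set `E`: every edge `e` is a copy of the interval
`[0, len e]`, and an equivalence relation on the set `E × Bool` of endpoints of the edges
(`(e, false)` is the endpoint `0` and `(e, true)` the endpoint `len e` of `e`) says which of them
are glued together. The vertices are the classes of this relation; loops, multiple edges and
vertices of degree two are allowed. -/
structure MetricGraph (E : Type*) where
  /-- the edge lengths -/
  len : E → ℝ
  len_pos : ∀ e, 0 < len e
  /-- the gluing of the endpoints -/
  glue : Setoid (E × Bool)

namespace MetricGraph

variable {E : Type*} (G : MetricGraph E)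

/-- An endpoint, as a point of the disjoint union of the edges. -/
def endpt (a : E × Bool) : Σ e, Icc (0 : ℝ) (G.len e) :=
  ⟨a.1, if a.2 then ⟨G.len a.1, (G.len_pos a.1).le, le_rfl⟩ else ⟨0, le_rfl, (G.len_pos a.1).le⟩⟩

theorem endpt_injective : Function.Injective G.endpt := by
  rintro ⟨e, b⟩ ⟨e', b'⟩ h
  obtain rfl : e = e' := congrArg Sigma.fst h
  have h2 : (if b then (⟨G.len e, (G.len_pos e).le, le_rfl⟩ : Icc (0 : ℝ) (G.len e))
        else ⟨0, le_rfl, (G.len_pos e).le⟩) =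
      if b' then ⟨G.len e, (G.len_pos e).le, le_rfl⟩ else ⟨0, le_rfl, (G.len_pos e).le⟩ :=
    eq_of_heq (Sigma.mk.inj h).2
  have h3 := (G.len_pos e).ne
  cases b <;> cases b' <;> simp_all [Subtype.ext_iff]

/-- The gluing relation, extended to all points of the edges: interior points of edges are
equivalent to themselves only. -/
def pointSetoid : Setoid (Σ e, Icc (0 : ℝ) (G.len e)) where
  r p q := p = q ∨ ∃ a b, G.glue a b ∧ p = G.endpt a ∧ q = G.endpt b
  iseqv := by
    refine ⟨fun p => Or.inl rfl, ?_, ?_⟩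
    · rintro p q (rfl | ⟨a, b, h, rfl, rfl⟩)
      · exact Or.inl rfl
      · exact Or.inr ⟨b, a, G.glue.symm h, rfl, rfl⟩
    · rintro p q r (rfl | ⟨a, b, h, rfl, rfl⟩) (rfl | ⟨c, d, h', hc, rfl⟩)
      · exact Or.inl rfl
      · exact Or.inr ⟨c, d, h', hc, rfl⟩
      · exact Or.inr ⟨a, b, h, rfl, rfl⟩
      · obtain rfl := G.endpt_injective hc
        exact Or.inr ⟨a, d, G.glue.trans h h', rfl, rfl⟩

/-- The metric graph as a topological space: the disjoint union of the edges modulo the gluing.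
(As there are finitely many edges, the quotient topology is that of the path metric.) -/
abbrev Points : Type _ := Quotient G.pointSetoid

/-- The point with coordinate `x ∈ [0, len e]` on the edge `e`. -/
noncomputable def pt (e : E) (x : ℝ) : G.Points :=
  Quotient.mk G.pointSetoid ⟨e, projIcc 0 (G.len e) (G.len_pos e).le x⟩

/-- The vertex to which an endpoint belongs. -/
def vertex (a : E × Bool) : G.Points := Quotient.mk G.pointSetoid (G.endpt a)

/-! ### Sobolev spaces and the Laplacian -/

/-- The restriction of a function to an edge. -/
noncomputable def onEdge (u : G.Points → ℂ) (e : E) : ℝ → ℂ := fun x => u (G.pt e x)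

/-- `u ∈ H¹(G)`: on every edge `u` belongs to `H¹`, that is, it is absolutely continuous with
square integrable derivative. Continuity at the vertices is automatic, as `u` is a function on
the glued space. -/
def IsH1 (u : G.Points → ℂ) : Prop :=
  ∀ e, AbsolutelyContinuousOnInterval (G.onEdge u e) 0 (G.len e) ∧
    MemLp (deriv (G.onEdge u e)) 2 (volume.restrict (Icc 0 (G.len e)))

/-- `u ∈ H¹₀(G; D)`: `u ∈ H¹(G)` and `u` vanishes on `D`. -/
def IsH10 (D : Set G.Points) (u : G.Points → ℂ) : Prop :=
  G.IsH1 u ∧ ∀ p ∈ D, u p = 0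

variable [Fintype E]

/-- The form `a(u, v) = ∫_G u' (conj v')`. -/
noncomputable def form (u v : G.Points → ℂ) : ℂ :=
  ∑ e, ∫ x in (0 : ℝ)..G.len e,
    deriv (G.onEdge u e) x * starRingEnd ℂ (deriv (G.onEdge v e) x)

/-- The inner product `∫_G u (conj v)` of `L²(G)`. -/
noncomputable def innerL2 (u v : G.Points → ℂ) : ℂ :=
  ∑ e, ∫ x in (0 : ℝ)..G.len e, G.onEdge u e x * starRingEnd ℂ (G.onEdge v e x)

/-- `u` lies in the kernel of `-Δ - s`, where `-Δ` is the operator on `L²(G)` associated with the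
form `a` on `H¹₀(G; D)`: the Laplacian with Dirichlet conditions on the set `D` of vertices and
natural (continuity and Kirchhoff) conditions at all other vertices. -/
def IsEigenfunction (D : Set G.Points) (s : ℝ) (u : G.Points → ℂ) : Prop :=
  G.IsH10 D u ∧ ∀ v, G.IsH10 D v → G.form u v = (s : ℂ) * G.innerL2 u v

/-- The `k`-th eigenvalue, counted with multiplicity, of the Laplacian with Dirichlet conditions on
`D` and natural conditions elsewhere: the smallest `t` such that the eigenspaces for eigenvalues
at most `t` have total dimension at least `k`. -/
noncomputable def eigenvalue (D : Set G.Points) (k : ℕ) : EReal :=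
  ⨅ (t : ℝ) (_ : (k : Cardinal) ≤
    Module.rank ℂ (Submodule.span ℂ {u | ∃ s ≤ t, G.IsEigenfunction D s u})), (t : EReal)

/-- `μ_k(G)`, the `k`-th eigenvalue of the Laplacian with natural conditions at all vertices. -/
noncomputable def naturalEigenvalue (k : ℕ) : EReal := G.eigenvalue ∅ k

/-! ### Cuts and partitions -/

/-- Nodes `0 = x₀ < x₁ < ⋯ < x_n = len e` on every edge, by which `G` is to be subdivided. -/
structure Subdivision {E : Type*} (G : MetricGraph E) where
  /-- the number of pieces into which an edge is divided -/
  num : E → ℕ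
  node : ∀ e, Fin (num e + 1) → ℝ
  node_strictMono : ∀ e, StrictMono (node e)
  node_zero : ∀ e, node e 0 = 0
  node_last : ∀ e, node e (Fin.last (num e)) = G.len e

/-- The representative of `G` which has the nodes of `S` as additional (dummy) vertices. Two
endpoints of its edges are glued if they are the same point of `G`. -/
noncomputable def Subdivision.graph {E : Type*} {G : MetricGraph E} (S : G.Subdivision) :
    MetricGraph (Σ e, Fin (S.num e)) where
  len f := S.node f.1 f.2.succ - S.node f.1 f.2.castSucc
  len_pos f := sub_pos.2 (S.node_strictMono f.1 Fin.castSucc_lt_succ)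
  glue := Setoid.ker fun a : (Σ e, Fin (S.num e)) × Bool =>
    G.pt a.1.1 (S.node a.1.1 (if a.2 then a.1.2.succ else a.1.2.castSucc))

/-- A cut of `G`: a representative of `G`, obtained by inserting dummy vertices, together with a
gluing of the same edges each of whose vertices is contained in a vertex of that representative. -/
structure Cut {E : Type*} (G : MetricGraph E) where
  subdiv : G.Subdivision
  glue : Setoid ((Σ e, Fin (subdiv.num e)) × Bool)
  glue_le : glue ≤ subdiv.graph.glue

namespace Cut

variable {E : Type*} {G : MetricGraph E} (C : G.Cut)

/-- The edges of the cut graph, and of the representative of `G` that is cut. -/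
abbrev Edges : Type _ := Σ e, Fin (C.subdiv.num e)

/-- The representative of `G` that is cut. -/
noncomputable abbrev base : MetricGraph C.Edges := C.subdiv.graph

/-- The metric graph that results from the cut. -/
noncomputable abbrev graph : MetricGraph C.Edges := { C.base with glue := C.glue }

/-- The connected components of the cut graph. They are the clusters of the exhaustive partition
of `G` arising from the cut. -/
abbrev Component : Type _ := ConnectedComponents C.graph.Points

/-- The component that contains the edge `f`. -/
noncomputable def edgeComponent (f : C.Edges) : C.Component :=
  ConnectedComponents.mk (C.graph.pt f 0)

/-- The edges of the component `c`. -/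
abbrev ComponentEdges (c : C.Component) : Type _ := {f : C.Edges // C.edgeComponent f = c}

/-- The component `c` of the cut graph, as a metric graph of its own: a cluster `G_i`. -/
noncomputable def cluster (c : C.Component) : MetricGraph (C.ComponentEdges c) where
  len f := C.graph.len f.1
  len_pos f := C.graph.len_pos f.1
  glue := Setoid.comap (fun a : C.ComponentEdges c × Bool => (a.1.1, a.2)) C.glue

/-- The cluster support `Ω_i`: the union of the edges of the cluster, as a subset of `G`. -/
def support (c : C.Component) : Set C.base.Points :=
  {p | ∃ f, C.edgeComponent f = c ∧ ∃ x ∈ Icc 0 (C.base.len f), p = C.base.pt f x}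

/-- The endpoint `a` belongs to a vertex of `G` that is cut nontrivially, that is, whose endpoints
form at least two vertices of the cut graph. -/
def IsCutEndpoint (a : C.Edges × Bool) : Prop :=
  ∃ b, C.base.glue a b ∧ ¬ C.glue a b

/-- The cut set: the vertices of `G` that are cut nontrivially. -/
def cutSet : Set C.base.Points :=
  {p | ∃ a, C.IsCutEndpoint a ∧ p = C.base.vertex a}

/-- The separation set: the union of the topological boundaries of the cluster supports. -/
def separationSet : Set C.base.Points :=
  ⋃ c, frontier (C.support c)

/-- The exhaustive partition that arises from the cut is an exhaustive rigid `k`-partition: it has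
`k` clusters, and its cut set and its separation set agree. -/
def IsRigidPartition (k : ℕ) : Prop :=
  Nat.card C.Component = k ∧ C.cutSet = C.separationSet

/-- The set `V_D(G_i)` of those vertices of a cluster which come from nontrivially cut vertices. -/
def dirichletVertices (c : C.Component) : Set (C.cluster c).Points :=
  {p | ∃ a : C.ComponentEdges c × Bool, C.IsCutEndpoint (a.1.1, a.2) ∧ p = (C.cluster c).vertex a}

open Classical in
/-- The Dirichlet energy `Λ^D_∞`: the maximum over the clusters of the first eigenvalue
`λ₁(G_i; V_D(G_i))`. -/
noncomputable def dirichletEnergy [Fintype E] : EReal :=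
  ⨆ c, (C.cluster c).eigenvalue (C.dirichletVertices c) 1

end Cut

/-- `L^D_{k,∞}(G)`: the infimum of the Dirichlet energies of all exhaustive rigid `k`-partitions. -/
noncomputable def dirichletMinimalEnergy {E : Type*} [Fintype E] (G : MetricGraph E) (k : ℕ) :
    EReal :=
  ⨅ (C : G.Cut) (_ : C.IsRigidPartition k), C.dirichletEnergy

end MetricGraph

/-!
The inequality is an instance of the min-max principle. Let a cut of `G` have `k` clusters and let
`t` exceed its Dirichlet energy. Every cluster `c` then has an eigenfunction `u c ≠ 0` for an
eigenvalue at most `t` which vanishes at the vertices that come from cut vertices. Two endpoints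
that are glued in `G` either are glued in the cut graph as well, and then belong to the same
cluster, or belong to a cut vertex, where all the functions `u c` vanish. Hence the multiples
`a c • u c` fit together to a function in `H¹(G)` (`Cut.glueFun`), the form and the `L²` norm are
sums over the clusters, and the Rayleigh quotient is at most `t` on a `k`-dimensional space of
functions. So `μ_k(G) ≤ t` (`naturalEigenvalue_le`).

Since eigenvalues are counted here by the eigenfunctions that exist, the min-max principle includes
the existence of eigenfunctions. It is proved for a Banach space `X` with a bounded operator `A`
(the derivative) and a compact operator `B` (the embedding into `L²`) such that `‖x‖` is controlled
by `‖A x‖ + ‖B x‖`. If the weak eigenvectors for eigenvalues at most `t` spanned a space `N` of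
dimension less than `k`, some trial vector `u ≠ 0` would satisfy `B u ⊥ B N`; the Rayleigh quotient
attains its minimum on the closed space `{v | B v ⊥ B N}` (`exists_weak_eigenvector`), and a
minimizer `w` is a weak eigenvector for an eigenvalue at most `t`. So `w` belongs to `N`, while
`B w ≠ 0` is orthogonal to `B N`: a contradiction.

To apply this, `H¹(G)` is represented by pairs of an initial value and a square integrable
derivative on every edge, subject to the continuity conditions at the vertices (`gluedData`). The
embedding into `L²(G)` is compact by the theorem of Arzelà and Ascoli, because `∫₀ˣ g` is the inner
product of `g` with the indicator function of `[0, x]`, which depends continuously on `x`.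
-/

/-! ### The min-max principle -/

open Filter Topology in
/-- If a closed subspace `W` contains a vector whose Rayleigh quotient `‖A u‖² / ‖B u‖²` is at most
`t`, then the minimum of the Rayleigh quotient on `W` is attained, and a minimizer is a weak
eigenvector with respect to test vectors in `W`. -/
theorem exists_weak_eigenvector {X K₁ K₂ : Type*} [NormedAddCommGroup X] [NormedSpace ℂ X]
    [CompleteSpace X] [NormedAddCommGroup K₁] [InnerProductSpace ℂ K₁]
    [NormedAddCommGroup K₂] [InnerProductSpace ℂ K₂]
    (A : X →L[ℂ] K₁) (B : X →L[ℂ] K₂) (hB : IsCompactOperator B)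
    {C : NNReal} (hC : ∀ x, ‖x‖ ≤ C * ‖(A x, B x)‖)
    (W : Submodule ℂ X) (hW : IsClosed (W : Set X)) {t : ℝ} {u : X} (huW : u ∈ W) (hu : u ≠ 0)
    (hut : ‖A u‖ ^ 2 ≤ t * ‖B u‖ ^ 2) :
    ∃ w ∈ W, B w ≠ 0 ∧ ∃ s ≤ t, ∀ v ∈ W, inner ℂ (A v) (A w) = (s : ℂ) * inner ℂ (B v) (B w) := by
  have hBu : B u ≠ 0 := by
    intro h
    have hA : A u = 0 := by
      rw [h] at hut
      simpa using hut
    have := hC u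
    rw [h, hA] at this
    simp at this
    exact hu this
  -- the infimum of the Rayleigh quotient on the unit sphere of `W` for the seminorm `‖B ·‖`
  let S : Set ℝ := (fun v => ‖A v‖ ^ 2) '' {v | v ∈ W ∧ ‖B v‖ = 1}
  have hSb : BddBelow S := ⟨0, by rintro _ ⟨v, -, rfl⟩; positivity⟩
  set s := sInf S with hs
  have hnorm : ∀ v ∈ W, s * ‖B v‖ ^ 2 ≤ ‖A v‖ ^ 2 := by
    intro v hv
    by_cases h : B v = 0
    · rw [h]; simp
    have hpos : 0 < ‖B v‖ := norm_pos_iff.2 h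
    have hmem : ‖A (((‖B v‖⁻¹ : ℝ) : ℂ) • v)‖ ^ 2 ∈ S :=
      ⟨_, ⟨W.smul_mem _ hv, by rw [map_smul, norm_smul]; simp [hpos.ne']⟩, rfl⟩
    have h1 := csInf_le hSb hmem
    rw [map_smul, norm_smul] at h1
    simp only [Complex.norm_real, norm_inv, norm_norm, mul_pow, inv_pow] at h1
    rw [← hs, inv_mul_eq_div, le_div_iff₀ (by positivity)] at h1
    exact h1
  have hSne : S.Nonempty :=
    ⟨_, (((‖B u‖⁻¹ : ℝ) : ℂ) • u), ⟨W.smul_mem _ huW, by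
      rw [map_smul, norm_smul]; simp [(norm_pos_iff.2 hBu).ne']⟩, rfl⟩
  have hst : s ≤ t := by
    have := (hnorm u huW).trans hut
    exact le_of_mul_le_mul_right this (by have := norm_pos_iff.2 hBu; positivity)
  have hs0 : 0 ≤ s := le_csInf hSne (by rintro _ ⟨v, -, rfl⟩; positivity)
  obtain ⟨a, -, ha, haS⟩ := exists_seq_tendsto_sInf hSne hSb
  choose v hv hva using haS
  -- a minimizing sequence is bounded, so `B v` converges along a subsequence
  obtain ⟨M, hM⟩ := ha.bddAbove_range
  have hM' : ∀ n, ‖A (v n)‖ ^ 2 ≤ M := fun n => by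
    have := hM ⟨n, rfl⟩
    rwa [← hva n] at this
  have hbd : ∀ n, v n ∈ Metric.closedBall (0 : X) (C * max (M + 1) 1) := by
    intro n
    rw [mem_closedBall_zero_iff]
    refine (hC _).trans (mul_le_mul_of_nonneg_left ?_ C.2)
    rw [Prod.norm_def]
    refine max_le_max ?_ (hv n).2.le
    nlinarith [hM' n, sq_nonneg (‖A (v n)‖ - 1)]
  obtain ⟨Kc, hKc, hsub⟩ := IsCompactOperator.image_closedBall_subset_compact
    (f := B.toLinearMap) hB (C * max (M + 1) 1)
  obtain ⟨b, -, φ, hφ, hb⟩ := hKc.tendsto_subseq (x := fun n => B (v n))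
    (fun n => hsub ⟨v n, hbd n, rfl⟩)
  have haφ : Tendsto (fun n => ‖A (v (φ n))‖ ^ 2) atTop (𝓝 s) := by
    have := ha.comp hφ.tendsto_atTop
    refine this.congr fun n => (hva (φ n)).symm
  -- by the parallelogram law `A v` is then a Cauchy sequence as well
  have hpar : ∀ x ∈ W, ∀ y ∈ W, ‖B x‖ = 1 → ‖B y‖ = 1 → ‖A x - A y‖ ^ 2 ≤
      2 * (‖A x‖ ^ 2 - s) + 2 * (‖A y‖ ^ 2 - s) + s * ‖B x - B y‖ ^ 2 := by
    intro x hx y hy hx1 hy1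
    have h1 := parallelogram_law_with_norm ℂ (A x) (A y)
    have h2 := parallelogram_law_with_norm ℂ (B x) (B y)
    have h3 := hnorm (x + y) (W.add_mem hx hy)
    rw [map_add, map_add] at h3
    rw [hx1, hy1] at h2
    nlinarith
  have hBc : CauchySeq fun n => B (v (φ n)) := hb.cauchySeq
  have hAc : CauchySeq fun n => A (v (φ n)) := by
    rw [Metric.cauchySeq_iff']
    intro ε hε
    have hδ : 0 < ε ^ 2 / (8 + s) := by positivity
    have h1 : ∀ᶠ n in atTop, ‖A (v (φ n))‖ ^ 2 < s + ε ^ 2 / (8 + s) :=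
      haφ.eventually (gt_mem_nhds (by linarith))
    obtain ⟨N₁, hN₁⟩ := eventually_atTop.1 h1
    obtain ⟨N₂, hN₂⟩ := Metric.cauchySeq_iff.1 hBc (Real.sqrt (ε ^ 2 / (8 + s)))
      (Real.sqrt_pos.2 hδ)
    refine ⟨max N₁ N₂, fun n hn => ?_⟩
    have e1 := hN₁ n (le_trans (le_max_left _ _) hn)
    have e2 := hN₁ _ (le_max_left N₁ N₂)
    have e3 := hN₂ n (le_trans (le_max_right _ _) hn) _ (le_max_right N₁ N₂)
    have e4 := hpar _ (hv (φ n)).1 _ (hv (φ (max N₁ N₂))).1 (hv _).2 (hv _).2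
    rw [dist_eq_norm] at e3 ⊢
    rw [Real.lt_sqrt (norm_nonneg _)] at e3
    have e5 : (8 + s) * (ε ^ 2 / (8 + s)) = ε ^ 2 := by field_simp
    refine lt_of_pow_lt_pow_left₀ 2 hε.le ?_
    nlinarith [mul_le_mul_of_nonneg_left e3.le hs0]
  have hvc : CauchySeq fun n => v (φ n) := by
    have hanti : AntilipschitzWith C (A.prod B) :=
      ContinuousLinearMap.antilipschitz_of_bound (A.prod B) (by simpa using hC)
    exact (hanti.isUniformInducing (A.prod B).uniformContinuous).cauchy_map_iff.1
      (hAc.prodMk hBc)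
  obtain ⟨w, hw⟩ := cauchySeq_tendsto_of_complete hvc
  have hwW : w ∈ W := hW.mem_of_tendsto hw (Eventually.of_forall fun n => (hv (φ n)).1)
  have hBw : ‖B w‖ = 1 := by
    refine tendsto_nhds_unique (((B.continuous.tendsto w).comp hw).norm) ?_
    refine tendsto_const_nhds.congr fun n => (hv (φ n)).2.symm
  have hAw : ‖A w‖ ^ 2 = s :=
    tendsto_nhds_unique ((((A.continuous.tendsto w).comp hw).norm).pow 2) haφ
  refine ⟨w, hwW, by rw [← norm_pos_iff, hBw]; exact one_pos, s, hst, ?_⟩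
  -- the nonnegative quadratic form `‖A v‖² - s ‖B v‖²` vanishes at `w`, so its first
  -- variation there is zero
  have hre : ∀ v ∈ W, RCLike.re (inner ℂ (A v) (A w)) = s * RCLike.re (inner ℂ (B v) (B w)) := by
    intro v hv
    have key : ∀ ε : ℝ, 0 ≤ ε * (2 * (RCLike.re (inner ℂ (A v) (A w)) -
        s * RCLike.re (inner ℂ (B v) (B w)))) + ε ^ 2 * (‖A v‖ ^ 2 - s * ‖B v‖ ^ 2) := by
      intro ε
      have h := hnorm ((ε : ℂ) • v + w) (W.add_mem (W.smul_mem _ hv) hwW)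
      rw [map_add, map_add, map_smul, map_smul, @norm_add_sq ℂ, @norm_add_sq ℂ,
        inner_smul_left, inner_smul_left, hBw, hAw] at h
      simp only [norm_smul, Complex.norm_real, Complex.conj_ofReal, mul_pow, Real.norm_eq_abs,
        sq_abs, RCLike.re_to_complex, Complex.re_ofReal_mul] at h ⊢
      nlinarith
    by_contra hne
    have hd : RCLike.re (inner ℂ (A v) (A w)) - s * RCLike.re (inner ℂ (B v) (B w)) ≠ 0 :=
      sub_ne_zero.2 hne
    set d := RCLike.re (inner ℂ (A v) (A w)) - s * RCLike.re (inner ℂ (B v) (B w))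
    set q := ‖A v‖ ^ 2 - s * ‖B v‖ ^ 2
    -- for this small parameter the linear term `2 ε d` outweighs the quadratic term `ε² q`
    have h := key (-d / (|q| + 1))
    have hq : 0 < |q| + 1 := by positivity
    have h2 : -d / (|q| + 1) * (2 * d) + (-d / (|q| + 1)) ^ 2 * q =
        d ^ 2 / (|q| + 1) ^ 2 * (q - 2 * (|q| + 1)) := by
      field_simp
      ring
    rw [h2] at h
    have h3 : 0 < d ^ 2 / (|q| + 1) ^ 2 := by positivity
    have h4 : q - 2 * (|q| + 1) < 0 := by linarith [le_abs_self q, abs_nonneg q]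
    nlinarith
  intro v hv
  apply Complex.ext
  · simpa using hre v hv
  -- the imaginary part follows by testing with `i v`
  · have h := hre (Complex.I • v) (W.smul_mem _ hv)
    simpa [inner_smul_left] using h

/-- The upper bound of the min-max principle: if the Rayleigh quotient is at most `t` on the range
of `T`, then the weak eigenvectors for eigenvalues at most `t` span a space of at least the same
dimension. -/
theorem finrank_le_rank_span_weak_eigenvectors {X K₁ K₂ V : Type*} [NormedAddCommGroup X]
    [NormedSpace ℂ X] [CompleteSpace X] [NormedAddCommGroup K₁] [InnerProductSpace ℂ K₁]
    [NormedAddCommGroup K₂] [InnerProductSpace ℂ K₂]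
    [AddCommGroup V] [Module ℂ V] [FiniteDimensional ℂ V]
    (A : X →L[ℂ] K₁) (B : X →L[ℂ] K₂) (hB : IsCompactOperator B)
    {C : NNReal} (hC : ∀ x, ‖x‖ ≤ C * ‖(A x, B x)‖) {t : ℝ}
    (T : V →ₗ[ℂ] X) (hT : Function.Injective T) (hTt : ∀ a, ‖A (T a)‖ ^ 2 ≤ t * ‖B (T a)‖ ^ 2) :
    (Module.finrank ℂ V : Cardinal) ≤ Module.rank ℂ (Submodule.span ℂ
      {w : X | ∃ s ≤ t, ∀ v, inner ℂ (A v) (A w) = (s : ℂ) * inner ℂ (B v) (B w)}) := by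
  set N : Submodule ℂ X := Submodule.span ℂ
      {w : X | ∃ s ≤ t, ∀ v, inner ℂ (A v) (A w) = (s : ℂ) * inner ℂ (B v) (B w)} with hN
  by_contra! hlt
  have hfin : FiniteDimensional ℂ N :=
    Module.rank_lt_aleph0_iff.1 (hlt.trans (Cardinal.natCast_lt_aleph0))
  rw [← Module.finrank_eq_rank, Nat.cast_lt] at hlt
  set Y : Submodule ℂ K₂ := N.map B.toLinearMap with hY
  have hYfin : FiniteDimensional ℂ Y := by rw [hY]; infer_instance
  -- a dimension count gives a trial vector `T a ≠ 0` with `B (T a)` orthogonal to `B N`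
  let R : V →ₗ[ℂ] Y := (Y.orthogonalProjectionOnto.toLinearMap ∘ₗ B.toLinearMap) ∘ₗ T
  have hYlt : Module.finrank ℂ Y < Module.finrank ℂ V :=
    (Submodule.finrank_map_le B.toLinearMap N).trans_lt hlt
  obtain ⟨a, ha, ha0⟩ :=
    (Submodule.ne_bot_iff _).1 (LinearMap.ker_ne_bot_of_finrank_lt (f := R) hYlt)
  let W : Submodule ℂ X := Yᗮ.comap B.toLinearMap
  have hW : IsClosed (W : Set X) := (Submodule.isClosed_orthogonal Y).preimage B.continuous
  have hTa : T a ∈ W := by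
    have : Y.orthogonalProjectionOnto (B (T a)) = 0 := ha
    exact Submodule.orthogonalProjectionOnto_eq_zero_iff.1 this
  obtain ⟨w, hwW, hBw, s, hst, hw⟩ := exists_weak_eigenvector A B hB hC W hW hTa
    (by rwa [Ne, map_eq_zero_iff T hT]) (hTt a)
  have hBN : ∀ e ∈ N, inner ℂ (B e) (B w) = 0 := fun e he =>
    hwW (B e) (Submodule.mem_map_of_mem he)
  have hAN : ∀ e ∈ N, inner ℂ (A e) (A w) = 0 := by
    intro e he
    induction he using Submodule.span_induction with
    | mem e he =>
      obtain ⟨s', hs', h⟩ := he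
      rw [← inner_conj_symm, h w, map_mul, inner_conj_symm,
        hBN e (Submodule.subset_span ⟨s', hs', h⟩), mul_zero]
    | zero => simp
    | add x y _ _ hx hy => rw [map_add, inner_add_left, hx, hy, add_zero]
    | smul c x _ hx => rw [map_smul, inner_smul_left, hx, mul_zero]
  -- `w` is an eigenvector on all of `X`, as `X = N + W` and both sides vanish for test vectors
  -- in `N`
  have hwN : w ∈ N := by
    refine Submodule.subset_span ⟨s, hst, fun v => ?_⟩
    obtain ⟨e, he, heq⟩ := (Y.orthogonalProjectionOnto (B v)).2
    have hve : v - e ∈ W := by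
      have := Y.sub_starProjection_mem_orthogonal (B v)
      rw [Submodule.starProjection_apply, ← heq] at this
      simpa [W] using this
    have h := hw _ hve
    rwa [map_sub, map_sub, inner_sub_left, inner_sub_left, hAN e he, hBN e he, sub_zero,
      sub_zero] at h
  exact hBw (inner_self_eq_zero.1 (hBN w hwN))

/-! ### Sobolev functions on intervals -/

open Filter AbsolutelyContinuousOnInterval in
theorem AbsolutelyContinuousOnInterval.congr {F G : ℝ → ℂ} {a b : ℝ}
    (hF : AbsolutelyContinuousOnInterval F a b) (h : EqOn F G (uIcc a b)) :
    AbsolutelyContinuousOnInterval G a b := by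
  refine Tendsto.congr' ?_ hF
  filter_upwards [eventually_inf_principal.mpr (Eventually.of_forall fun _ h => h)] with I hI
  refine Finset.sum_congr rfl fun i hi => ?_
  rw [h (hI.1 i hi).1, h (hI.1 i hi).2]

open Filter AbsolutelyContinuousOnInterval in
theorem IntervalIntegrable.absolutelyContinuousOnInterval_integral {f : ℝ → ℂ} {a b : ℝ}
    (hf : IntervalIntegrable f volume a b) :
    AbsolutelyContinuousOnInterval (fun x => ∫ y in a..x, f y) a b := by
  refine squeeze_zero' ?_ ?_
    (hf.norm.absolutelyContinuousOnInterval_intervalIntegral left_mem_uIcc)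
  · filter_upwards with I
    exact Finset.sum_nonneg fun _ _ => dist_nonneg
  filter_upwards [eventually_inf_principal.mpr (Eventually.of_forall fun _ h => h)] with I hI
  refine Finset.sum_le_sum fun i hi => ?_
  obtain ⟨h1, h2⟩ := hI.1 i hi
  have hsub : ∀ {x}, x ∈ uIcc a b → IntervalIntegrable f volume a x := fun hx =>
    hf.mono_set (uIcc_subset_uIcc left_mem_uIcc hx)
  rw [dist_comm, dist_comm (∫ y in a..(I.2 i).1, ‖f y‖), dist_eq_norm, Real.dist_eq,
    intervalIntegral.integral_interval_sub_left (hsub h2) (hsub h1),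
    intervalIntegral.integral_interval_sub_left (hsub h2).norm (hsub h1).norm]
  exact intervalIntegral.norm_integral_le_abs_integral_norm

theorem AbsolutelyContinuousOnInterval.sub_eq_integral_deriv {F : ℝ → ℂ} {a b : ℝ}
    (hF : AbsolutelyContinuousOnInterval F a b)
    (hF' : IntervalIntegrable (deriv F) volume a b) {x : ℝ} (hx : x ∈ uIcc a b) :
    F x = F a + ∫ y in a..x, deriv F y := by
  obtain ⟨c, hc⟩ := (hF.sub hF'.absolutelyContinuousOnInterval_integral).const_of_ae_hasDerivAt_zero
    (by
      filter_upwards [hF.boundedVariationOn.ae_differentiableAt_of_mem_uIcc,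
        hF'.ae_hasDerivAt_integral] with x hx₁ hx₂ hx₃
      simpa using (hx₁ hx₃).hasDerivAt.sub (hx₂ hx₃ a left_mem_uIcc))
  have h1 := hc x hx
  have h2 := hc a left_mem_uIcc
  simp only [Pi.sub_apply, intervalIntegral.integral_same, sub_zero] at h1 h2
  rw [h2, ← h1, sub_add_cancel]

/-- `F` belongs to `H¹(a, b)`, where `a ≤ b`: the function `F` is the integral on `[a, b]` of its
derivative, which is square integrable. For this form of the definition, `isH1On_iff` shows the
equivalence with absolute continuity, and subintervals can be put together. -/
def IsH1On (F : ℝ → ℂ) (a b : ℝ) : Prop :=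
  MemLp (deriv F) 2 (volume.restrict (Icc a b)) ∧ ∀ x ∈ Icc a b, F x = F a + ∫ y in a..x, deriv F y

theorem MeasureTheory.MemLp.intervalIntegrable_of_Icc {f : ℝ → ℂ} {a b : ℝ} (hab : a ≤ b)
    (hf : MemLp f 2 (volume.restrict (Icc a b))) : IntervalIntegrable f volume a b := by
  rw [intervalIntegrable_iff_integrableOn_Icc_of_le hab]
  exact hf.integrable one_le_two

theorem isH1On_iff {F : ℝ → ℂ} {a b : ℝ} (hab : a ≤ b) :
    IsH1On F a b ↔ AbsolutelyContinuousOnInterval F a b ∧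
      MemLp (deriv F) 2 (volume.restrict (Icc a b)) := by
  constructor
  · rintro ⟨h1, h2⟩
    refine ⟨?_, h1⟩
    have hc : AbsolutelyContinuousOnInterval (fun _ => F a) a b :=
      (LipschitzWith.const (F a)).lipschitzOnWith.absolutelyContinuousOnInterval
    refine (hc.add
      (h1.intervalIntegrable_of_Icc hab).absolutelyContinuousOnInterval_integral).congr ?_
    rw [uIcc_of_le hab]
    exact fun x hx => (h2 x hx).symm
  · rintro ⟨h1, h2⟩
    exact ⟨h2, fun x hx => h1.sub_eq_integral_deriv (h2.intervalIntegrable_of_Icc hab)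
      (by rwa [uIcc_of_le hab])⟩

theorem deriv_ae_eq_of_eq_add_integral {F g : ℝ → ℂ} {a b : ℝ} (hab : a ≤ b)
    (hg : IntervalIntegrable g volume a b) {c : ℂ}
    (hF : ∀ x ∈ Icc a b, F x = c + ∫ y in a..x, g y) :
    deriv F =ᵐ[volume.restrict (Icc a b)] g := by
  rw [← restrict_Ioo_eq_restrict_Icc]
  refine (ae_restrict_iff' measurableSet_Ioo).2 ?_
  filter_upwards [hg.ae_hasDerivAt_integral] with x hx hxI
  have h := (hx (by rw [uIcc_of_le hab]; exact Ioo_subset_Icc_self hxI) a left_mem_uIcc).const_add c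
  refine (h.congr_of_eventuallyEq ?_).deriv
  filter_upwards [isOpen_Ioo.mem_nhds hxI] with y hy
  exact hF y (Ioo_subset_Icc_self hy)

theorem isH1On_of_eq_add_integral {F g : ℝ → ℂ} {a b : ℝ} (hab : a ≤ b)
    (hg : MemLp g 2 (volume.restrict (Icc a b))) {c : ℂ}
    (hF : ∀ x ∈ Icc a b, F x = c + ∫ y in a..x, g y) : IsH1On F a b := by
  have hae := deriv_ae_eq_of_eq_add_integral hab (hg.intervalIntegrable_of_Icc hab) hF
  refine ⟨hg.ae_eq hae.symm, fun x hx => ?_⟩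
  have h0 := hF a (left_mem_Icc.2 hab)
  rw [intervalIntegral.integral_same, add_zero] at h0
  rw [hF x hx, h0]
  congr 1
  refine intervalIntegral.integral_congr_ae ?_
  filter_upwards [(ae_restrict_iff' measurableSet_Icc).1 hae] with y hy hyx
  rw [uIoc_of_le hx.1] at hyx
  exact (hy ⟨hyx.1.le, hyx.2.trans hx.2⟩).symm

theorem IsH1On.trans {F : ℝ → ℂ} {a b c : ℝ} (hab : a ≤ b) (hbc : b ≤ c) (h₁ : IsH1On F a b)
    (h₂ : IsH1On F b c) : IsH1On F a c := by
  have hm : MemLp (deriv F) 2 (volume.restrict (Icc a c)) := by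
    rw [← Icc_union_Icc_eq_Icc hab hbc]
    have hmeas : AEStronglyMeasurable (deriv F)
        (volume.restrict (Icc a b ∪ Icc b c)) := (stronglyMeasurable_deriv F).aestronglyMeasurable
    rw [memLp_two_iff_integrable_sq_norm hmeas]
    exact IntegrableOn.union
      ((memLp_two_iff_integrable_sq_norm h₁.1.1).1 h₁.1)
      ((memLp_two_iff_integrable_sq_norm h₂.1.1).1 h₂.1)
  refine ⟨hm, fun x hx => ?_⟩
  rcases le_total x b with hxb | hxb
  · exact h₁.2 x ⟨hx.1, hxb⟩
  · have hi := hm.intervalIntegrable_of_Icc (hab.trans hbc)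
    rw [h₂.2 x ⟨hxb, hx.2⟩, h₁.2 b ⟨hab, le_rfl⟩, add_assoc,
      intervalIntegral.integral_add_adjacent_intervals]
    · exact hi.mono_set (by
        rw [uIcc_of_le hab, uIcc_of_le (hab.trans hbc)]; exact Icc_subset_Icc le_rfl hbc)
    · exact hi.mono_set (by
        rw [uIcc_of_le hxb, uIcc_of_le (hab.trans hbc)]; exact Icc_subset_Icc hab hx.2)

theorem deriv_eq_deriv_of_shift {F U : ℝ → ℂ} {n l : ℝ} (h : ∀ y ∈ Icc 0 l, F (n + y) = U y)
    {y : ℝ} (hy : y ∈ Ioo 0 l) : deriv F (n + y) = deriv U y := by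
  rw [← deriv_comp_const_add]
  refine Filter.EventuallyEq.deriv_eq ?_
  filter_upwards [isOpen_Ioo.mem_nhds hy] with z hz
  exact h z (Ioo_subset_Icc_self hz)

/-- A function is in `H¹(n, n + l)` if it agrees on `[n, n + l]` with a translate of a function in
`H¹(0, l)`; its values elsewhere do not matter. -/
theorem IsH1On.of_shift {F U : ℝ → ℂ} {n l : ℝ} (hl : 0 ≤ l) (hU : IsH1On U 0 l)
    (h : ∀ y ∈ Icc 0 l, F (n + y) = U y) : IsH1On F n (n + l) := by
  have hg : MemLp (fun x => deriv U (x - n)) 2 (volume.restrict (Icc n (n + l))) := by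
    have hmp : MeasurePreserving (fun x : ℝ => x - n) (volume.restrict (Icc n (n + l)))
        (volume.restrict (Icc 0 l)) := by
      have := (measurePreserving_sub_right volume n).restrict_preimage (s := Icc 0 l)
        measurableSet_Icc
      simpa [add_comm] using this
    exact hU.1.comp_measurePreserving hmp
  refine isH1On_of_eq_add_integral (by linarith) hg (c := U 0) fun x hx => ?_
  have h1 := h (x - n) ⟨by linarith [hx.1], by linarith [hx.2]⟩
  rw [add_sub_cancel] at h1
  rw [h1, hU.2 _ ⟨by linarith [hx.1], by linarith [hx.2]⟩,
    intervalIntegral.integral_comp_sub_right (fun y => deriv U y), sub_self]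

theorem exists_mem_Icc_castSucc_succ {m : ℕ} (n : Fin (m + 1) → ℝ) (h : n 0 < n (Fin.last m))
    {x : ℝ} (hx : x ∈ Icc (n 0) (n (Fin.last m))) :
    ∃ i : Fin m, x ∈ Icc (n i.castSucc) (n i.succ) := by
  induction m with
  | zero => exact absurd h (lt_irrefl _)
  | succ m ih =>
    rcases le_or_gt (n (Fin.last m).castSucc) x with hle | hlt
    · exact ⟨Fin.last m, hle, hx.2⟩
    · obtain ⟨i, hi⟩ := ih (fun j => n j.castSucc) (hx.1.trans_lt hlt) ⟨hx.1, hlt.le⟩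
      exact ⟨i.castSucc, hi⟩

theorem isH1On_self (F : ℝ → ℂ) (a : ℝ) : IsH1On F a a := by
  refine ⟨by simp, fun x hx => ?_⟩
  rw [Icc_self] at hx
  rw [hx]
  simp

theorem isH1On_of_nodes {F : ℝ → ℂ} {m : ℕ} {n : Fin (m + 1) → ℝ} (hn : Monotone n)
    (h : ∀ i : Fin m, IsH1On F (n i.castSucc) (n i.succ)) (j : Fin (m + 1)) :
    IsH1On F (n 0) (n j) := by
  induction j using Fin.induction with
  | zero => exact isH1On_self _ _
  | succ i ih => exact ih.trans (hn (Fin.zero_le _)) (hn Fin.castSucc_lt_succ.le) (h i)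

theorem intervalIntegral_eq_sum_nodes {W : ℝ → ℂ} {m : ℕ} (n : Fin (m + 1) → ℝ)
    (h : ∀ i : Fin m, IntervalIntegrable W volume (n i.castSucc) (n i.succ)) :
    IntervalIntegrable W volume (n 0) (n (Fin.last m)) ∧
      ∫ x in n 0..n (Fin.last m), W x = ∑ i : Fin m, ∫ x in n i.castSucc..n i.succ, W x := by
  induction m with
  | zero => simp
  | succ m ih =>
    obtain ⟨h1, h2⟩ := ih (fun j => n j.castSucc) fun i => h i.castSucc
    refine ⟨h1.trans (h (Fin.last m)), ?_⟩
    rw [Fin.sum_univ_castSucc]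
    refine Eq.trans (intervalIntegral.integral_add_adjacent_intervals h1 (h (Fin.last m))).symm ?_
    exact congrArg (· + _) h2

/-! ### Compactness of the Volterra operator -/

/-- For a continuous family of vectors `φ x` indexed by a compact space, the operator sending `g`
to the continuous function `x ↦ ⟪φ x, g⟫`. -/
noncomputable def innerCLM {X K : Type*} [TopologicalSpace X] [CompactSpace X]
    [NormedAddCommGroup K] [InnerProductSpace ℂ K] (φ : C(X, K)) :
    K →L[ℂ] BoundedContinuousFunction X ℂ :=
  LinearMap.mkContinuous
    { toFun := fun g => BoundedContinuousFunction.mkOfCompact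
        ⟨fun x => inner ℂ (φ x) g, by fun_prop⟩
      map_add' := fun g h => by ext x; simp
      map_smul' := fun c g => by ext x; simp }
    ‖φ‖ fun g => by
      refine (BoundedContinuousFunction.norm_le (by positivity)).2 fun x => ?_
      exact (norm_inner_le_norm _ _).trans
        (mul_le_mul_of_nonneg_right (φ.norm_coe_le_norm x) (norm_nonneg g))

theorem isCompactOperator_innerCLM {X K : Type*} [TopologicalSpace X] [CompactSpace X]
    [NormedAddCommGroup K] [InnerProductSpace ℂ K] (φ : C(X, K)) :
    IsCompactOperator (innerCLM φ) := by
  refine (isCompactOperator_iff_isCompact_closure_image_closedBall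
    (innerCLM φ).toLinearMap one_pos).2 ?_
  refine BoundedContinuousFunction.arzela_ascoli (Metric.closedBall 0 ‖φ‖)
    (isCompact_closedBall _ _) _ ?_ ?_
  · rintro _ x ⟨g, hg, rfl⟩
    rw [mem_closedBall_zero_iff] at hg ⊢
    calc ‖innerCLM φ g x‖ ≤ ‖φ x‖ * ‖g‖ := norm_inner_le_norm _ _
      _ ≤ ‖φ‖ * 1 := mul_le_mul (φ.norm_coe_le_norm x) hg (norm_nonneg _) (norm_nonneg _)
      _ = ‖φ‖ := mul_one _
  · intro x₀
    refine Metric.equicontinuousAt_of_continuity_modulus (fun x => ‖φ x₀ - φ x‖) ?_ _ ?_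
    · have : Continuous fun x => ‖φ x₀ - φ x‖ := by fun_prop
      simpa using this.tendsto x₀
    · filter_upwards with x
      rintro ⟨_, g, hg, rfl⟩
      rw [mem_closedBall_zero_iff] at hg
      change dist (inner ℂ (φ x₀) g) (inner ℂ (φ x) g) ≤ _
      rw [dist_eq_norm, ← inner_sub_left]
      exact (norm_inner_le_norm _ _).trans (mul_le_of_le_one_right (norm_nonneg _) hg)

/-- The space `L²(0, l)`. -/
abbrev IntervalL2 (l : ℝ) : Type := Lp ℂ 2 (volume.restrict (Icc 0 l))

/-- The indicator function of `(-∞, x]`, as an element of `L²(0, l)`. -/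
noncomputable def indicatorIic (l x : ℝ) : IntervalL2 l :=
  indicatorConstLp 2 (measurableSet_Iic (a := x)) (measure_ne_top _ _) (1 : ℂ)

theorem continuous_indicatorIic (l : ℝ) : Continuous (indicatorIic l) := by
  refine continuous_indicatorConstLp_set (by simp) fun x => ?_
  have hle : ∀ y, (volume.restrict (Icc 0 l)) (symmDiff (Iic y) (Iic x)) ≤
      ENNReal.ofReal |y - x| := by
    intro y
    refine (Measure.restrict_apply_le _ _).trans ?_
    refine (measure_mono (t := uIcc x y) ?_).trans (by rw [Real.volume_interval])
    intro z hz
    simp only [mem_symmDiff, mem_Iic, not_le] at hz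
    rcases hz with h | h
    · exact mem_uIcc.2 (Or.inl ⟨h.2.le, h.1⟩)
    · exact mem_uIcc.2 (Or.inr ⟨h.2.le, h.1⟩)
  refine tendsto_of_tendsto_of_tendsto_of_le_of_le tendsto_const_nhds ?_ (fun _ => bot_le) hle
  have : Continuous fun y : ℝ => ENNReal.ofReal |y - x| :=
    ENNReal.continuous_ofReal.comp (by fun_prop)
  simpa using this.tendsto x

theorem inner_indicatorIic {l x : ℝ} (hx : x ∈ Icc 0 l) (g : IntervalL2 l) :
    inner ℂ (indicatorIic l x) g = ∫ y in (0 : ℝ)..x, g y := by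
  rw [indicatorIic, L2.inner_indicatorConstLp_one, Measure.restrict_restrict measurableSet_Iic,
    intervalIntegral.integral_of_le hx.1, ← integral_Icc_eq_integral_Ioc]
  congr 2
  ext y
  simp only [mem_inter_iff, mem_Iic, mem_Icc]
  constructor
  · exact fun h => ⟨h.2.1, h.1⟩
  · exact fun h => ⟨h.2, h.1, h.2.trans hx.2⟩

/-- The Volterra operator `g ↦ ∫₀ˣ g` on `L²(0, l)`, with values in the continuous functions on
`[0, l]`, extended by constants to the line. -/
noncomputable def volterra {l : ℝ} (hl : 0 ≤ l) :
    IntervalL2 l →L[ℂ] BoundedContinuousFunction ℝ ℂ :=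
  (BoundedContinuousFunction.compContinuousCLM ℂ ℂ ⟨projIcc 0 l hl, continuous_projIcc⟩).comp
    (innerCLM ⟨fun x : Icc 0 l => indicatorIic l x,
      (continuous_indicatorIic l).comp continuous_subtype_val⟩)

theorem isCompactOperator_volterra {l : ℝ} (hl : 0 ≤ l) : IsCompactOperator (volterra hl) := by
  rw [volterra, ContinuousLinearMap.coe_comp]
  exact (isCompactOperator_innerCLM _).clm_comp _

theorem volterra_apply {l : ℝ} (hl : 0 ≤ l) (g : IntervalL2 l) {x : ℝ} (hx : x ∈ Icc 0 l) :
    volterra hl g x = ∫ y in (0 : ℝ)..x, g y := by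
  change inner ℂ (indicatorIic l (projIcc 0 l hl x)) g = _
  rw [projIcc_of_mem hl hx, inner_indicatorIic hx]

/-- The inner product of `L²(0, l)` in terms of representatives. Mathlib's inner product is
conjugate linear in its first argument, so the order is reversed. -/
theorem inner_intervalL2 {l : ℝ} (hl : 0 ≤ l) (f g : IntervalL2 l) {φ ψ : ℝ → ℂ}
    (hφ : φ =ᵐ[volume.restrict (Icc 0 l)] f) (hψ : ψ =ᵐ[volume.restrict (Icc 0 l)] g) :
    inner ℂ g f = ∫ x in (0 : ℝ)..l, φ x * starRingEnd ℂ (ψ x) := by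
  rw [L2.inner_def, intervalIntegral.integral_of_le hl, ← integral_Icc_eq_integral_Ioc]
  refine integral_congr_ae ?_
  filter_upwards [hφ, hψ] with x h1 h2
  rw [h1, h2, RCLike.inner_apply]

theorem IsCompactOperator.pi {ι X : Type*} [Finite ι] {Y : ι → Type*} [Zero X] [TopologicalSpace X]
    [∀ i, TopologicalSpace (Y i)] {f : ∀ i, X → Y i} (hf : ∀ i, IsCompactOperator (f i)) :
    IsCompactOperator fun x i => f i x := by
  choose K hK hf using hf
  refine ⟨univ.pi K, isCompact_univ_pi hK, ?_⟩
  have : (fun x i => f i x) ⁻¹' univ.pi K = ⋂ i, f i ⁻¹' K i := by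
    ext x; simp
  rw [this]
  exact Filter.iInter_mem.2 hf

/-! ### The Sobolev space of a metric graph -/

namespace MetricGraph

section

variable {E : Type*} (G : MetricGraph E)

/-- The coordinate of an endpoint on its edge. -/
def endCoord (a : E × Bool) : ℝ := if a.2 then G.len a.1 else 0

theorem endCoord_mem (a : E × Bool) : G.endCoord a ∈ Icc 0 (G.len a.1) := by
  unfold endCoord
  have := (G.len_pos a.1).le
  split_ifs <;> simp [this]

theorem endpt_eq (a : E × Bool) : G.endpt a = ⟨a.1, G.endCoord a, G.endCoord_mem a⟩ := by
  obtain ⟨e, b⟩ := a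
  cases b <;> rfl

theorem pt_of_mem {e : E} {x : ℝ} (hx : x ∈ Icc 0 (G.len e)) :
    G.pt e x = Quotient.mk G.pointSetoid ⟨e, x, hx⟩ := by
  rw [pt, projIcc_of_mem _ hx]

theorem pt_endCoord (a : E × Bool) : G.pt a.1 (G.endCoord a) = G.vertex a := by
  rw [vertex, endpt_eq, pt_of_mem]

theorem exists_eq_pt (p : G.Points) : ∃ e, ∃ x ∈ Icc 0 (G.len e), p = G.pt e x := by
  obtain ⟨⟨e, x, hx⟩, rfl⟩ := Quotient.exists_rep p
  exact ⟨e, x, hx, (G.pt_of_mem hx).symm⟩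

theorem vertex_eq {a b : E × Bool} (h : G.glue a b) : G.vertex a = G.vertex b :=
  Quotient.sound (Or.inr ⟨a, b, h, rfl, rfl⟩)

theorem isH1_iff {u : G.Points → ℂ} : G.IsH1 u ↔ ∀ e, IsH1On (G.onEdge u e) 0 (G.len e) :=
  forall_congr' fun e => (isH1On_iff (G.len_pos e).le).symm

/-- The initial value on every edge, and a square integrable derivative: the data which determine
a function that is `H¹` on every edge, without any condition at the vertices. -/
abbrev EdgeData : Type _ := ∀ e, ℂ × IntervalL2 (G.len e)

/-- The function `x ↦ c + ∫₀ˣ g` on the edge `e`, where `(c, g)` are the data on `e`. -/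
noncomputable def edgeFun (e : E) : G.EdgeData →L[ℂ] BoundedContinuousFunction ℝ ℂ :=
  (ContinuousLinearMap.toSpanSingleton ℂ (1 : BoundedContinuousFunction ℝ ℂ)).comp
      ((ContinuousLinearMap.fst ℂ ℂ (IntervalL2 (G.len e))).comp (ContinuousLinearMap.proj e)) +
    (volterra (G.len_pos e).le).comp
      ((ContinuousLinearMap.snd ℂ ℂ (IntervalL2 (G.len e))).comp (ContinuousLinearMap.proj e))

theorem edgeFun_eq (e : E) (h : G.EdgeData) : G.edgeFun e h =
    (h e).1 • (1 : BoundedContinuousFunction ℝ ℂ) + volterra (G.len_pos e).le (h e).2 := rfl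

theorem edgeFun_apply {e : E} (h : G.EdgeData) {x : ℝ} (hx : x ∈ Icc 0 (G.len e)) :
    G.edgeFun e h x = (h e).1 + ∫ y in (0 : ℝ)..x, (h e).2 y := by
  rw [edgeFun_eq, BoundedContinuousFunction.add_apply, volterra_apply _ _ hx]
  simp

theorem isCompactOperator_edgeFun (e : E) : IsCompactOperator (G.edgeFun e) := by
  refine IsCompactOperator.add ?_ ?_
  · exact (isCompactOperator_of_locallyCompactSpace_rng
      (ContinuousLinearMap.toSpanSingleton ℂ (1 : BoundedContinuousFunction ℝ ℂ))).comp_clm _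
  · exact (isCompactOperator_volterra _).comp_clm _

/-- The data that satisfy the continuity conditions at the vertices: a representation of `H¹(G)` as
a Banach space. -/
def gluedData : Submodule ℂ G.EdgeData where
  carrier := {h | ∀ a b, G.glue a b →
    G.edgeFun a.1 h (G.endCoord a) = G.edgeFun b.1 h (G.endCoord b)}
  zero_mem' := fun a b _ => by simp
  add_mem' := fun hx hy a b hab => by simp [hx a b hab, hy a b hab]
  smul_mem' := fun c x hx a b hab => by simp [hx a b hab]

theorem isClosed_gluedData : IsClosed (G.gluedData : Set G.EdgeData) := by
  have : (G.gluedData : Set G.EdgeData) = ⋂ a, ⋂ b, ⋂ _ : G.glue a b,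
      {h | G.edgeFun a.1 h (G.endCoord a) = G.edgeFun b.1 h (G.endCoord b)} := by
    ext h; simp [gluedData]
  rw [this]
  refine isClosed_iInter fun a => isClosed_iInter fun b => isClosed_iInter fun _ => ?_
  have hc : ∀ a : E × Bool, Continuous fun h => G.edgeFun a.1 h (G.endCoord a) := fun a =>
    ((BoundedContinuousFunction.evalCLM ℂ (G.endCoord a)).comp (G.edgeFun a.1)).continuous
  exact isClosed_eq (hc a) (hc b)

instance : CompleteSpace G.gluedData := G.isClosed_gluedData.completeSpace_coe

/-- The function on `G` with given data. At a vertex it is evaluated at a representative, the choice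
of which is immaterial for data that satisfy the continuity conditions. -/
noncomputable def toFun : G.gluedData →ₗ[ℂ] (G.Points → ℂ) where
  toFun h p := G.edgeFun p.out.1 h p.out.2
  map_add' h h' := by ext p; simp
  map_smul' c h := by ext p; simp

theorem onEdge_toFun (h : G.gluedData) {e : E} {x : ℝ} (hx : x ∈ Icc 0 (G.len e)) :
    G.onEdge (G.toFun h) e x = G.edgeFun e h x := by
  rw [onEdge, G.pt_of_mem hx]
  change G.edgeFun (Quotient.mk G.pointSetoid ⟨e, x, hx⟩).out.1 h
    (Quotient.mk G.pointSetoid ⟨e, x, hx⟩).out.2 = _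
  rcases (Quotient.mk_out (s := G.pointSetoid) ⟨e, x, hx⟩ :) with heq | ⟨a, b, hab, ha, hb⟩
  · rw [heq]
  · have h1 := h.2 a b hab
    rw [G.endpt_eq] at ha hb
    rw [ha]
    rw [Sigma.mk.inj_iff] at hb
    obtain ⟨rfl, hb⟩ := hb
    have hx' : x = G.endCoord b := congrArg Subtype.val (eq_of_heq hb)
    rw [hx']
    exact h1

theorem onEdge_toFun_eq_add_integral (h : G.gluedData) {e : E} {x : ℝ} (hx : x ∈ Icc 0 (G.len e)) :
    G.onEdge (G.toFun h) e x = (h.1 e).1 + ∫ y in (0 : ℝ)..x, (h.1 e).2 y := by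
  rw [G.onEdge_toFun h hx, edgeFun_apply _ _ hx]

theorem isH1_toFun (h : G.gluedData) : G.IsH1 (G.toFun h) :=
  G.isH1_iff.2 fun e => isH1On_of_eq_add_integral (G.len_pos e).le (Lp.memLp (h.1 e).2)
    fun _ hx => G.onEdge_toFun_eq_add_integral h hx

theorem deriv_onEdge_toFun (h : G.gluedData) (e : E) :
    deriv (G.onEdge (G.toFun h) e) =ᵐ[volume.restrict (Icc 0 (G.len e))] (h.1 e).2 :=
  deriv_ae_eq_of_eq_add_integral (G.len_pos e).le
    ((Lp.memLp (h.1 e).2).intervalIntegrable_of_Icc (G.len_pos e).le)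
    fun _ hx => G.onEdge_toFun_eq_add_integral h hx

/-- Every function in `H¹(G)` comes from its initial values and derivatives on the edges. -/
theorem exists_toFun_eq {u : G.Points → ℂ} (hu : G.IsH1 u) : ∃ h, G.toFun h = u := by
  rw [isH1_iff] at hu
  let h : G.EdgeData := fun e => (G.onEdge u e 0, (hu e).1.toLp)
  have hval : ∀ e, ∀ x ∈ Icc 0 (G.len e), G.edgeFun e h x = G.onEdge u e x := by
    intro e x hx
    rw [G.edgeFun_apply h hx, (hu e).2 x hx]
    congr 1
    refine intervalIntegral.integral_congr_ae ?_
    filter_upwards [(ae_restrict_iff' measurableSet_Icc).1 (hu e).1.coeFn_toLp] with y hy hyx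
    rw [uIoc_of_le hx.1] at hyx
    exact hy ⟨hyx.1.le, hyx.2.trans hx.2⟩
  have hh : h ∈ G.gluedData := by
    intro a b hab
    rw [hval _ _ (G.endCoord_mem a), hval _ _ (G.endCoord_mem b), onEdge, onEdge, pt_endCoord,
      pt_endCoord, G.vertex_eq hab]
  refine ⟨⟨h, hh⟩, funext fun p => ?_⟩
  obtain ⟨e, x, hx, rfl⟩ := G.exists_eq_pt p
  exact (G.onEdge_toFun ⟨h, hh⟩ hx).trans (hval e x hx)

/-- The space `L²(G)`, as the Hilbert sum of the spaces `L²(0, len e)`. -/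
abbrev L2 : Type _ := PiLp 2 fun e => IntervalL2 (G.len e)

/-- The operator that sends data to their derivatives in `L²(G)`. -/
noncomputable def derivCLM : G.EdgeData →L[ℂ] G.L2 :=
  ((PiLp.continuousLinearEquiv 2 ℂ fun e => IntervalL2 (G.len e)).symm :
      (∀ e, IntervalL2 (G.len e)) →L[ℂ] G.L2).comp
    (ContinuousLinearMap.pi fun e =>
      (ContinuousLinearMap.snd ℂ ℂ (IntervalL2 (G.len e))).comp (ContinuousLinearMap.proj e))

/-- The operator that sends data to the functions with these data, as elements of `L²(G)`. -/
noncomputable def embedCLM : G.EdgeData →L[ℂ] G.L2 :=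
  ((PiLp.continuousLinearEquiv 2 ℂ fun e => IntervalL2 (G.len e)).symm :
      (∀ e, IntervalL2 (G.len e)) →L[ℂ] G.L2).comp
    (ContinuousLinearMap.pi fun e =>
      (BoundedContinuousFunction.toLp 2 (volume.restrict (Icc 0 (G.len e))) ℂ).comp (G.edgeFun e))

theorem embedCLM_apply (h : G.EdgeData) (e : E) : G.embedCLM h e =
    BoundedContinuousFunction.toLp 2 (volume.restrict (Icc 0 (G.len e))) ℂ (G.edgeFun e h) := rfl

variable [Fintype E]

theorem isCompactOperator_embedCLM : IsCompactOperator G.embedCLM := by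
  rw [embedCLM, ContinuousLinearMap.coe_comp]
  refine IsCompactOperator.clm_comp ?_ _
  exact IsCompactOperator.pi fun e => (G.isCompactOperator_edgeFun e).clm_comp
    (BoundedContinuousFunction.toLp 2 (volume.restrict (Icc 0 (G.len e))) ℂ)

/-- The data are bounded by the `L²` norms of the function and of its derivative. The reason is that
they depend continuously on both: if `f = c + V g` on `[0, l]` with the Volterra operator `V`, then
`c` is the mean value of `f - V g`. -/
theorem exists_norm_le_mul : ∃ C : NNReal, ∀ h : G.EdgeData,
    ‖h‖ ≤ C * ‖(G.derivCLM h, G.embedCLM h)‖ := by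
  let ι : ∀ e, BoundedContinuousFunction ℝ ℂ →L[ℂ] IntervalL2 (G.len e) := fun e =>
    BoundedContinuousFunction.toLp 2 (volume.restrict (Icc 0 (G.len e))) ℂ
  -- the operator that recovers the data from the derivative `a` and the function `b`
  let L : G.L2 × G.L2 →L[ℂ] G.EdgeData := ContinuousLinearMap.pi fun e =>
    let a := (PiLp.proj 2 (𝕜 := ℂ) (fun e => IntervalL2 (G.len e)) e).comp
      (ContinuousLinearMap.fst ℂ G.L2 G.L2)
    let b := (PiLp.proj 2 (𝕜 := ℂ) (fun e => IntervalL2 (G.len e)) e).comp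
      (ContinuousLinearMap.snd ℂ G.L2 G.L2)
    ((((G.len e : ℂ)⁻¹) • (innerSL ℂ (indicatorIic (G.len e) (G.len e))).comp
      (b - ((ι e).comp (volterra (G.len_pos e).le)).comp a))).prod a
  have hL : ∀ h, L (G.derivCLM h, G.embedCLM h) = h := by
    intro h
    funext e
    have hone : inner ℂ (indicatorIic (G.len e) (G.len e)) (ι e 1) = G.len e := by
      rw [inner_indicatorIic (right_mem_Icc.2 (G.len_pos e).le),
        intervalIntegral.integral_of_le (G.len_pos e).le, ← integral_Icc_eq_integral_Ioc,
        integral_congr_ae (BoundedContinuousFunction.coeFn_toLp _ _ ℂ _)]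
      simp [(G.len_pos e).le]
    have hsub : ι e (G.edgeFun e h) - ι e (volterra (G.len_pos e).le (h e).2) =
        (h e).1 • ι e 1 := by
      rw [edgeFun_eq, map_add, map_smul, add_sub_cancel_right]
    refine Prod.ext ?_ rfl
    change (G.len e : ℂ)⁻¹ * inner ℂ (indicatorIic (G.len e) (G.len e))
      (ι e (G.edgeFun e h) - ι e (volterra (G.len_pos e).le (h e).2)) = (h e).1
    rw [hsub, inner_smul_right, hone, mul_comm, mul_assoc, mul_inv_cancel₀, mul_one]
    exact_mod_cast (G.len_pos e).ne'
  refine ⟨‖L‖₊, fun h => ?_⟩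
  calc ‖h‖ = ‖L (G.derivCLM h, G.embedCLM h)‖ := by rw [hL]
    _ ≤ _ := L.le_opNorm _

theorem inner_derivCLM (h h' : G.gluedData) :
    inner ℂ (G.derivCLM h') (G.derivCLM h) = G.form (G.toFun h) (G.toFun h') := by
  rw [PiLp.inner_apply, form]
  exact Finset.sum_congr rfl fun e _ => inner_intervalL2 (G.len_pos e).le _ _
    (G.deriv_onEdge_toFun h e) (G.deriv_onEdge_toFun h' e)

theorem inner_embedCLM (h h' : G.gluedData) :
    inner ℂ (G.embedCLM h') (G.embedCLM h) = G.innerL2 (G.toFun h) (G.toFun h') := by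
  rw [PiLp.inner_apply, innerL2]
  have hae : ∀ (h : G.gluedData) e, G.onEdge (G.toFun h) e
      =ᵐ[volume.restrict (Icc 0 (G.len e))] G.embedCLM h e := by
    intro h e
    rw [embedCLM_apply]
    refine Filter.EventuallyEq.trans ?_ (BoundedContinuousFunction.coeFn_toLp _ _ ℂ _).symm
    exact (ae_restrict_iff' measurableSet_Icc).2 (Filter.Eventually.of_forall fun x hx =>
      G.onEdge_toFun h hx)
  exact Finset.sum_congr rfl fun e _ => inner_intervalL2 (G.len_pos e).le _ _ (hae h e) (hae h' e)

theorem toFun_injective : Function.Injective G.toFun := by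
  refine (injective_iff_map_eq_zero _).2 fun h h0 => ?_
  have hA : G.derivCLM h = 0 := by
    rw [← inner_self_eq_zero (𝕜 := ℂ), inner_derivCLM, h0]
    have : ∀ e, G.onEdge 0 e = fun _ => 0 := fun e => rfl
    simp [form, this]
  have hB : G.embedCLM h = 0 := by
    rw [← inner_self_eq_zero (𝕜 := ℂ), inner_embedCLM, h0]
    have : ∀ e, G.onEdge 0 e = fun _ => 0 := fun e => rfl
    simp [innerL2, this]
  obtain ⟨C, hC⟩ := G.exists_norm_le_mul
  have := hC h
  rw [hA, hB] at this
  simpa using this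

/-- The variational upper bound for eigenvalues: if the form does not exceed `t` times the square
of the `L²` norm on the image of an injective linear map from a space of dimension `k` to `H¹(G)`,
then `μ_k(G) ≤ t`. -/
theorem naturalEigenvalue_le {V : Type*} [AddCommGroup V] [Module ℂ V] [FiniteDimensional ℂ V]
    (T : V →ₗ[ℂ] (G.Points → ℂ)) (hT : Function.Injective T) (hH1 : ∀ a, G.IsH1 (T a)) {t : ℝ}
    (ht : ∀ a, (G.form (T a) (T a)).re ≤ t * (G.innerL2 (T a) (T a)).re) :
    G.naturalEigenvalue (Module.finrank ℂ V) ≤ t := by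
  obtain ⟨C, hC⟩ := G.exists_norm_le_mul
  let Φ := LinearEquiv.ofInjective G.toFun G.toFun_injective
  let T' : V →ₗ[ℂ] G.gluedData :=
    Φ.symm.toLinearMap ∘ₗ T.codRestrict (LinearMap.range G.toFun) fun a => G.exists_toFun_eq (hH1 a)
  have hT' : ∀ a, G.toFun (T' a) = T a := fun a =>
    congrArg Subtype.val (Φ.apply_symm_apply ⟨T a, G.exists_toFun_eq (hH1 a)⟩)
  have hrank := finrank_le_rank_span_weak_eigenvectors
    (G.derivCLM.comp G.gluedData.subtypeL) (G.embedCLM.comp G.gluedData.subtypeL)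
    (G.isCompactOperator_embedCLM.comp_clm _) (fun x => hC x) (t := t) T'
    (fun a b hab => hT (by rw [← hT', ← hT', hab])) (fun a => by
      have h1 := G.inner_derivCLM (T' a) (T' a)
      have h2 := G.inner_embedCLM (T' a) (T' a)
      rw [inner_self_eq_norm_sq_to_K, hT'] at h1 h2
      have h3 := ht a
      rw [← h1, ← h2] at h3
      simpa [← Complex.ofReal_pow] using h3)
  refine iInf₂_le_of_le t ?_ le_rfl
  refine hrank.trans ?_
  rw [(Submodule.equivMapOfInjective G.toFun G.toFun_injective _).rank_eq, Submodule.map_span]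
  refine Submodule.rank_mono (Submodule.span_mono ?_)
  rintro _ ⟨w, ⟨s, hs, hw⟩, rfl⟩
  refine ⟨s, hs, ⟨G.isH1_toFun w, fun _ h => h.elim⟩, fun v hv => ?_⟩
  obtain ⟨h, rfl⟩ := G.exists_toFun_eq hv.1
  rw [← inner_derivCLM, ← inner_embedCLM]
  exact hw h

end

end MetricGraph

/-! ### Functions composed of functions on the clusters -/

namespace MetricGraph

section

variable {E : Type*} (G : MetricGraph E)

theorem continuous_pt (e : E) : Continuous (G.pt e) :=
  continuous_quotient_mk'.comp (continuous_sigmaMk.comp continuous_projIcc)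

theorem connectedComponents_pt (e : E) (x y : ℝ) :
    (ConnectedComponents.mk (G.pt e x)) = ConnectedComponents.mk (G.pt e y) :=
  ConnectedComponents.coe_eq_coe'.2
    ((isPreconnected_range (G.continuous_pt e)).subset_connectedComponent
      (mem_range_self y) (mem_range_self x))

end

namespace Cut

variable {E : Type*} {G : MetricGraph E} (C : G.Cut)

/-- The coordinate, on the edge of `G` that contains it, of the initial point of an edge of the
cut graph. -/
def start (f : C.Edges) : ℝ := C.subdiv.node f.1 f.2.castSucc

theorem start_nonneg (f : C.Edges) : 0 ≤ C.start f := by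
  rw [← C.subdiv.node_zero f.1]
  exact (C.subdiv.node_strictMono f.1).monotone (Fin.zero_le _)

theorem start_add_len (f : C.Edges) : C.start f + C.base.len f = C.subdiv.node f.1 f.2.succ :=
  add_sub_cancel _ _

theorem start_add_len_le (f : C.Edges) : C.start f + C.base.len f ≤ G.len f.1 := by
  rw [start_add_len, ← C.subdiv.node_last f.1]
  exact (C.subdiv.node_strictMono f.1).monotone (Fin.le_last _)

theorem start_add_mem {f : C.Edges} {y : ℝ} (hy : y ∈ Icc 0 (C.base.len f)) :
    C.start f + y ∈ Icc 0 (G.len f.1) :=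
  ⟨add_nonneg (C.start_nonneg f) hy.1, by linarith [C.start_add_len_le f, hy.2]⟩

/-- Endpoints of the pieces are glued in the subdivided graph if they are the same point of `G`;
here that point is expressed by `start` and `endCoord`. -/
theorem base_glue_iff {a b : C.Edges × Bool} : C.base.glue a b ↔
    G.pt a.1.1 (C.start a.1 + C.base.endCoord a) =
      G.pt b.1.1 (C.start b.1 + C.base.endCoord b) := by
  have h : ∀ a : C.Edges × Bool, C.start a.1 + C.base.endCoord a =
      C.subdiv.node a.1.1 (if a.2 then a.1.2.succ else a.1.2.castSucc) := by
    rintro ⟨f, b⟩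
    cases b
    · exact add_zero _
    · exact C.start_add_len f
  rw [h, h]
  rfl

theorem exists_piece (p : G.Points) :
    ∃ f : C.Edges, ∃ y ∈ Icc 0 (C.base.len f), p = G.pt f.1 (C.start f + y) := by
  obtain ⟨e, x, hx, rfl⟩ := G.exists_eq_pt p
  have h0 := C.subdiv.node_zero e
  have h1 := C.subdiv.node_last e
  obtain ⟨i, hi⟩ := exists_mem_Icc_castSucc_succ (C.subdiv.node e)
    (by rw [h0, h1]; exact G.len_pos e) (x := x) (by rwa [h0, h1])
  refine ⟨⟨e, i⟩, x - C.subdiv.node e i.castSucc, ⟨sub_nonneg.2 hi.1, ?_⟩, ?_⟩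
  · exact sub_le_sub_right hi.2 _
  · exact congrArg (G.pt e) (add_sub_cancel _ _).symm

/-- A point of `G` is represented by more than one point of the pieces only if these
are endpoints that are glued together in the subdivided graph. -/
theorem piece_unique {f f' : C.Edges} {y y' : ℝ} (hy : y ∈ Icc 0 (C.base.len f))
    (hy' : y' ∈ Icc 0 (C.base.len f'))
    (h : G.pt f.1 (C.start f + y) = G.pt f'.1 (C.start f' + y')) :
    (f = f' ∧ y = y') ∨ ∃ b b' : Bool, C.base.glue (f, b) (f', b') ∧
      y = C.base.endCoord (f, b) ∧ y' = C.base.endCoord (f', b') := by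
  -- it suffices to find endpoints, as the gluing of the subdivided graph is equality in `G`
  suffices hs : (f = f' ∧ y = y') ∨ ((∃ b, y = C.base.endCoord (f, b)) ∧
      ∃ b', y' = C.base.endCoord (f', b')) by
    refine hs.imp_right ?_
    rintro ⟨⟨b, hb⟩, b', hb'⟩
    exact ⟨b, b', C.base_glue_iff.2 (by rw [← hb, ← hb']; exact h), hb, hb'⟩
  have hend : ∀ {f : C.Edges} {y : ℝ}, y = 0 ∨ y = C.base.len f →
      ∃ b, y = C.base.endCoord (f, b) := by
    rintro f y (h | h)
    · exact ⟨false, h⟩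
    · exact ⟨true, h⟩
  rw [G.pt_of_mem (C.start_add_mem hy), G.pt_of_mem (C.start_add_mem hy')] at h
  rcases Quotient.exact h with heq | ⟨a, b, -, ha, hb⟩
  · obtain ⟨e, j⟩ := f
    obtain ⟨e', j'⟩ := f'
    obtain rfl : e = e' := congrArg Sigma.fst heq
    have hx : C.start ⟨e, j⟩ + y = C.start ⟨e, j'⟩ + y' :=
      congrArg Subtype.val (eq_of_heq (Sigma.mk.inj heq).2)
    have hmono : ∀ {i i' : Fin (C.subdiv.num e)}, i < i' →
        C.start ⟨e, i⟩ + C.base.len ⟨e, i⟩ ≤ C.start ⟨e, i'⟩ := by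
      intro i i' hi
      rw [start_add_len]
      exact (C.subdiv.node_strictMono e).monotone (Fin.le_def.2 (by simpa using hi))
    rcases lt_trichotomy j j' with hj | rfl | hj
    · have := hmono hj
      exact Or.inr ⟨hend (Or.inr (by linarith [hy.2, hy'.1])),
        hend (Or.inl (by linarith [hy.2, hy'.1]))⟩
    · exact Or.inl ⟨rfl, by linarith⟩
    · have := hmono hj
      exact Or.inr ⟨hend (Or.inl (by linarith [hy.1, hy'.2])),
        hend (Or.inr (by linarith [hy.1, hy'.2]))⟩
  · have hG : ∀ {f : C.Edges} {y : ℝ} (hy : y ∈ Icc 0 (C.base.len f)) {a : E × Bool},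
        (⟨f.1, C.start f + y, C.start_add_mem hy⟩ : Σ e, Icc (0 : ℝ) (G.len e)) = G.endpt a →
        y = 0 ∨ y = C.base.len f := by
      intro f y hy a ha
      obtain ⟨e, j⟩ := f
      obtain ⟨e', b⟩ := a
      obtain rfl : e = e' := congrArg Sigma.fst ha
      rw [G.endpt_eq] at ha
      have hx : C.start ⟨e, j⟩ + y = G.endCoord (e, b) :=
        congrArg Subtype.val (eq_of_heq (Sigma.mk.inj ha).2)
      cases b
      · have h0 : G.endCoord (e, false) = 0 := rfl
        left
        linarith [C.start_nonneg ⟨e, j⟩, hy.1]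
      · have h1 : G.endCoord (e, true) = G.len e := rfl
        right
        have := C.start_add_len_le ⟨e, j⟩
        simp only at this
        linarith [hy.2]
    exact Or.inr ⟨hend (hG hy ha), hend (hG hy' hb)⟩

variable {C} in
theorem edgeComponent_eq_of_glue {a b : C.Edges × Bool} (h : C.glue a b) :
    C.edgeComponent a.1 = C.edgeComponent b.1 := by
  have hv : C.graph.vertex a = C.graph.vertex b := C.graph.vertex_eq h
  rw [edgeComponent, edgeComponent, C.graph.connectedComponents_pt a.1 0 (C.graph.endCoord a),
    C.graph.connectedComponents_pt b.1 0 (C.graph.endCoord b), pt_endCoord, pt_endCoord, hv]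

/-- The restriction to an edge of the cut graph of a family of functions on the clusters. -/
noncomputable def pieceFun (u : ∀ c, (C.cluster c).Points → ℂ) (f : C.Edges) : ℝ → ℂ :=
  (C.cluster (C.edgeComponent f)).onEdge (u (C.edgeComponent f)) ⟨f, rfl⟩

theorem pieceFun_eq (u : ∀ c, (C.cluster c).Points → ℂ) {c : C.Component} {f : C.Edges}
    (h : C.edgeComponent f = c) : C.pieceFun u f = (C.cluster c).onEdge (u c) ⟨f, h⟩ := by
  subst h
  rfl

theorem pieceFun_endCoord (u : ∀ c, (C.cluster c).Points → ℂ) {c : C.Component}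
    {a : C.Edges × Bool} (h : C.edgeComponent a.1 = c) :
    C.pieceFun u a.1 (C.base.endCoord a) = u c ((C.cluster c).vertex (⟨a.1, h⟩, a.2)) := by
  rw [C.pieceFun_eq u h, ← pt_endCoord]
  rfl

/-- The Dirichlet conditions at the cut vertices make the functions on the clusters fit together. -/
theorem pieceFun_eq_of_glue {u : ∀ c, (C.cluster c).Points → ℂ}
    (hu : ∀ c, ∀ p ∈ C.dirichletVertices c, u c p = 0) {a b : C.Edges × Bool}
    (h : C.base.glue a b) :
    C.pieceFun u a.1 (C.base.endCoord a) = C.pieceFun u b.1 (C.base.endCoord b) := by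
  by_cases hC : C.glue a b
  · rw [C.pieceFun_endCoord u (edgeComponent_eq_of_glue hC), C.pieceFun_endCoord u rfl]
    congr 1
    exact (C.cluster _).vertex_eq hC
  -- otherwise both endpoints belong to a vertex that is cut nontrivially
  · have hzero : ∀ {a b : C.Edges × Bool}, C.base.glue a b → ¬ C.glue a b →
        C.pieceFun u a.1 (C.base.endCoord a) = 0 := by
      intro a b h hC
      rw [C.pieceFun_endCoord u rfl]
      exact hu _ _ ⟨_, ⟨b, h, hC⟩, rfl⟩
    rw [hzero h hC, hzero (C.base.glue.symm h) fun h' => hC (C.glue.symm h')]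

/-- The function on `G` that is composed of functions on the clusters. Every point of `G` is
evaluated in a chosen piece of the subdivision; by `onEdge_glueFun` the choice is immaterial if the
functions satisfy the Dirichlet conditions. -/
noncomputable def glueFun (u : ∀ c, (C.cluster c).Points → ℂ) : G.Points → ℂ := fun p =>
  C.pieceFun u (C.exists_piece p).choose (C.exists_piece p).choose_spec.choose

theorem onEdge_glueFun {u : ∀ c, (C.cluster c).Points → ℂ}
    (hu : ∀ c, ∀ p ∈ C.dirichletVertices c, u c p = 0) (f : C.Edges) {y : ℝ}
    (hy : y ∈ Icc 0 (C.base.len f)) :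
    G.onEdge (C.glueFun u) f.1 (C.start f + y) = C.pieceFun u f y := by
  have key : ∀ {f' : C.Edges} {y' : ℝ}, y' ∈ Icc 0 (C.base.len f') →
      G.pt f.1 (C.start f + y) = G.pt f'.1 (C.start f' + y') →
      C.pieceFun u f' y' = C.pieceFun u f y := by
    intro f' y' hy' h
    rcases C.piece_unique hy hy' h with ⟨rfl, rfl⟩ | ⟨b, b', hb, rfl, rfl⟩
    · rfl
    · exact (C.pieceFun_eq_of_glue hu hb).symm
  obtain ⟨hy', h⟩ := (C.exists_piece (G.pt f.1 (C.start f + y))).choose_spec.choose_spec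
  exact key hy' h

theorem isH1On_pieceFun {u : ∀ c, (C.cluster c).Points → ℂ} (hu : ∀ c, (C.cluster c).IsH1 (u c))
    (f : C.Edges) : IsH1On (C.pieceFun u f) 0 (C.base.len f) :=
  (isH1_iff _).1 (hu (C.edgeComponent f)) ⟨f, rfl⟩

theorem isH1_glueFun {u : ∀ c, (C.cluster c).Points → ℂ}
    (hu : ∀ c, (C.cluster c).IsH10 (C.dirichletVertices c) (u c)) : G.IsH1 (C.glueFun u) := by
  refine G.isH1_iff.2 fun e => ?_
  have h := isH1On_of_nodes (F := G.onEdge (C.glueFun u) e) (C.subdiv.node_strictMono e).monotone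
    (fun i => ?_) (Fin.last _)
  · rwa [C.subdiv.node_zero, C.subdiv.node_last] at h
  · rw [← C.start_add_len ⟨e, i⟩]
    exact (C.isH1On_pieceFun (fun c => (hu c).1) ⟨e, i⟩).of_shift (C.base.len_pos _).le
      fun y hy => C.onEdge_glueFun (fun c => (hu c).2) ⟨e, i⟩ hy

theorem integral_mul_conj_eq_sum {φ : ℝ → ℂ} {ψ : C.Edges → ℝ → ℂ} {e : E}
    (hφ : MemLp φ 2 (volume.restrict (Icc 0 (G.len e))))
    (h : ∀ i, ∀ y ∈ Ioo 0 (C.base.len ⟨e, i⟩), φ (C.start ⟨e, i⟩ + y) = ψ ⟨e, i⟩ y) :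
    ∫ x in (0 : ℝ)..G.len e, φ x * starRingEnd ℂ (φ x) =
      ∑ i, ∫ y in (0 : ℝ)..C.base.len ⟨e, i⟩, ψ ⟨e, i⟩ y * starRingEnd ℂ (ψ ⟨e, i⟩ y) := by
  have hint : IntervalIntegrable (fun x => φ x * starRingEnd ℂ (φ x)) volume 0 (G.len e) := by
    rw [intervalIntegrable_iff_integrableOn_Icc_of_le (G.len_pos e).le]
    exact hφ.integrable_mul hφ.star
  have h1 := (intervalIntegral_eq_sum_nodes (C.subdiv.node e) fun i => hint.mono_set (by
    have h1 := C.start_add_mem (f := ⟨e, i⟩) (left_mem_Icc.2 (C.base.len_pos _).le)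
    have h2 := C.start_add_mem (f := ⟨e, i⟩) (right_mem_Icc.2 (C.base.len_pos _).le)
    rw [add_zero] at h1
    rw [start_add_len] at h2
    rw [uIcc_of_le (G.len_pos e).le]
    exact uIcc_subset_Icc h1 h2)).2
  rw [C.subdiv.node_zero, C.subdiv.node_last] at h1
  rw [h1]
  refine Finset.sum_congr rfl fun i _ => ?_
  have hl := (C.base.len_pos ⟨e, i⟩).le
  have h2 := intervalIntegral.integral_comp_add_left (a := 0) (b := C.base.len ⟨e, i⟩)
    (fun x => φ x * starRingEnd ℂ (φ x)) (C.start ⟨e, i⟩)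
  rw [add_zero, start_add_len] at h2
  refine h2.symm.trans ?_
  rw [intervalIntegral.integral_of_le hl, intervalIntegral.integral_of_le hl,
    integral_Ioc_eq_integral_Ioo, integral_Ioc_eq_integral_Ioo]
  refine setIntegral_congr_fun measurableSet_Ioo fun y hy => ?_
  simp only [h i y hy]

/-- Every edge of the cut graph belongs to exactly one cluster. -/
theorem sum_edges_eq_sum_clusters [Fintype E] [Fintype C.Component]
    [∀ c, Fintype (C.ComponentEdges c)] (J : C.Edges → ℂ) :
    ∑ e, ∑ i, J ⟨e, i⟩ = ∑ c, ∑ f : C.ComponentEdges c, J f.1 := by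
  rw [← Fintype.sum_sigma', ← Fintype.sum_sigma' (fun c (f : C.ComponentEdges c) => J f.1)]
  exact (Fintype.sum_equiv (Equiv.sigmaFiberEquiv C.edgeComponent) _ _ fun _ => rfl).symm

theorem form_glueFun [Fintype E] [Fintype C.Component] [∀ c, Fintype (C.ComponentEdges c)]
    {u : ∀ c, (C.cluster c).Points → ℂ}
    (hu : ∀ c, (C.cluster c).IsH10 (C.dirichletVertices c) (u c)) :
    G.form (C.glueFun u) (C.glueFun u) = ∑ c, (C.cluster c).form (u c) (u c) := by
  calc G.form (C.glueFun u) (C.glueFun u) = ∑ e, ∑ i, ∫ y in (0 : ℝ)..C.base.len ⟨e, i⟩,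
        deriv (C.pieceFun u ⟨e, i⟩) y * starRingEnd ℂ (deriv (C.pieceFun u ⟨e, i⟩) y) :=
      Finset.sum_congr rfl fun e _ => C.integral_mul_conj_eq_sum
        (ψ := fun f => deriv (C.pieceFun u f)) (C.isH1_glueFun hu e).2 fun i y hy =>
          deriv_eq_deriv_of_shift (fun y hy => C.onEdge_glueFun (fun c => (hu c).2) ⟨e, i⟩ hy) hy
    _ = _ := by
      rw [C.sum_edges_eq_sum_clusters fun f => ∫ y in (0 : ℝ)..C.base.len f,
        deriv (C.pieceFun u f) y * starRingEnd ℂ (deriv (C.pieceFun u f) y)]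
      refine Finset.sum_congr rfl fun c _ => Finset.sum_congr rfl fun f _ => ?_
      rw [C.pieceFun_eq u f.2]
      rfl

theorem innerL2_glueFun [Fintype E] [Fintype C.Component] [∀ c, Fintype (C.ComponentEdges c)]
    {u : ∀ c, (C.cluster c).Points → ℂ}
    (hu : ∀ c, (C.cluster c).IsH10 (C.dirichletVertices c) (u c)) :
    G.innerL2 (C.glueFun u) (C.glueFun u) = ∑ c, (C.cluster c).innerL2 (u c) (u c) := by
  calc G.innerL2 (C.glueFun u) (C.glueFun u) = ∑ e, ∑ i, ∫ y in (0 : ℝ)..C.base.len ⟨e, i⟩,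
        C.pieceFun u ⟨e, i⟩ y * starRingEnd ℂ (C.pieceFun u ⟨e, i⟩ y) :=
      Finset.sum_congr rfl fun e _ => C.integral_mul_conj_eq_sum (ψ := C.pieceFun u)
        (by
          have h := (C.isH1_glueFun hu e).1
          obtain ⟨M, hM⟩ := h.exists_bound
          have hc := h.continuousOn
          rw [uIcc_of_le (G.len_pos e).le] at hM hc
          exact MemLp.of_bound (hc.aestronglyMeasurable measurableSet_Icc) M
            ((ae_restrict_iff' measurableSet_Icc).2 (Filter.Eventually.of_forall hM)))
        fun i y hy =>
          C.onEdge_glueFun (fun c => (hu c).2) ⟨e, i⟩ (Ioo_subset_Icc_self hy)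
    _ = _ := by
      rw [C.sum_edges_eq_sum_clusters fun f => ∫ y in (0 : ℝ)..C.base.len f,
        C.pieceFun u f y * starRingEnd ℂ (C.pieceFun u f y)]
      refine Finset.sum_congr rfl fun c _ => Finset.sum_congr rfl fun f _ => ?_
      rw [C.pieceFun_eq u f.2]
      rfl

end Cut

/-! ### Comparison of the eigenvalues -/

section

variable {E : Type*} (G : MetricGraph E)

theorem isH10_smul {D : Set G.Points} {u : G.Points → ℂ} (hu : G.IsH10 D u) (a : ℂ) :
    G.IsH10 D (a • u) := by
  refine ⟨fun e => ⟨(hu.1 e).1.const_smul a, ?_⟩, fun p hp => by simp [hu.2 p hp]⟩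
  have : deriv (G.onEdge (a • u) e) = a • deriv (G.onEdge u e) :=
    funext fun x => deriv_fun_const_smul_field a _
  rw [this]
  exact (hu.1 e).2.const_smul a

variable [Fintype E]

theorem form_smul (u : G.Points → ℂ) (a : ℂ) :
    G.form (a • u) (a • u) = ((‖a‖ ^ 2 : ℝ) : ℂ) * G.form u u := by
  have : ∀ e, deriv (G.onEdge (a • u) e) = a • deriv (G.onEdge u e) :=
    fun e => funext fun x => deriv_fun_const_smul_field a _
  simp only [form, this, Finset.mul_sum, ← intervalIntegral.integral_const_mul]
  refine Finset.sum_congr rfl fun e _ => intervalIntegral.integral_congr fun x _ => ?_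
  simp only [Pi.smul_apply, smul_eq_mul, map_mul]
  rw [Complex.ofReal_pow, ← Complex.mul_conj']
  ring

theorem innerL2_smul (u : G.Points → ℂ) (a : ℂ) :
    G.innerL2 (a • u) (a • u) = ((‖a‖ ^ 2 : ℝ) : ℂ) * G.innerL2 u u := by
  simp only [innerL2, Finset.mul_sum, ← intervalIntegral.integral_const_mul]
  refine Finset.sum_congr rfl fun e _ => intervalIntegral.integral_congr fun x _ => ?_
  simp only [onEdge, Pi.smul_apply, smul_eq_mul, map_mul]
  rw [Complex.ofReal_pow, ← Complex.mul_conj']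
  ring

theorem innerL2_self_re_nonneg (u : G.Points → ℂ) : 0 ≤ (G.innerL2 u u).re := by
  rw [innerL2, Complex.re_sum]
  refine Finset.sum_nonneg fun e _ => ?_
  simp only [Complex.mul_conj, intervalIntegral.integral_ofReal, Complex.ofReal_re]
  exact intervalIntegral.integral_nonneg (G.len_pos e).le fun x _ => Complex.normSq_nonneg _

variable {G}

theorem exists_isEigenfunction_of_eigenvalue_one_lt {D : Set G.Points} {t : ℝ}
    (h : G.eigenvalue D 1 < t) : ∃ s ≤ t, ∃ u, u ≠ 0 ∧ G.IsEigenfunction D s u := by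
  obtain ⟨t', h⟩ := iInf_lt_iff.1 h
  obtain ⟨hrank, ht'⟩ := iInf_lt_iff.1 h
  have hne : Submodule.span ℂ {u | ∃ s ≤ t', G.IsEigenfunction D s u} ≠ ⊥ := by
    intro h0
    rw [h0, rank_bot] at hrank
    simp at hrank
  rw [Ne, Submodule.span_eq_bot] at hne
  push Not at hne
  obtain ⟨u, ⟨s, hs, hu⟩, hu0⟩ := hne
  exact ⟨s, hs.trans (EReal.coe_lt_coe_iff.1 ht').le, u, hu0, hu⟩

/-- For every cut into finitely many clusters, the Dirichlet energy bounds the natural eigenvalue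
whose number is the number of clusters: the linear combinations of eigenfunctions of the clusters
are trial functions on `G`. -/
theorem naturalEigenvalue_le_dirichletEnergy (C : G.Cut) [Finite C.Component] :
    G.naturalEigenvalue (Nat.card C.Component) ≤ C.dirichletEnergy := by
  classical
  refine EReal.le_of_forall_lt_iff_le.1 fun t ht => ?_
  cases nonempty_fintype C.Component
  have hc := fun c => exists_isEigenfunction_of_eigenvalue_one_lt
    ((le_iSup (fun c => (C.cluster c).eigenvalue (C.dirichletVertices c) 1) c).trans_lt ht)
  choose s hs u hu0 hu using hc
  have hH : ∀ a : C.Component → ℂ, ∀ c,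
      (C.cluster c).IsH10 (C.dirichletVertices c) (a c • u c) := fun a c =>
    (C.cluster c).isH10_smul (hu c).1 (a c)
  let T : (C.Component → ℂ) →ₗ[ℂ] (G.Points → ℂ) :=
    { toFun := fun a => C.glueFun fun c => a c • u c
      map_add' := fun a b => by
        ext p; simp [Cut.glueFun, Cut.pieceFun, onEdge, add_mul]
      map_smul' := fun r a => by
        ext p; simp [Cut.glueFun, Cut.pieceFun, onEdge, mul_assoc] }
  have hT : Function.Injective T := by
    refine (injective_iff_map_eq_zero _).2 fun a ha => funext fun c => ?_
    obtain ⟨p, hp⟩ := Function.ne_iff.1 (hu0 c)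
    obtain ⟨f, y, hy, rfl⟩ := (C.cluster c).exists_eq_pt p
    have h1 := C.onEdge_glueFun (fun c => (hH a c).2) f.1 hy
    rw [C.pieceFun_eq _ f.2] at h1
    have h2 : G.onEdge (T a) f.1.1 (C.start f.1 + y) = 0 := by rw [ha]; rfl
    have h3 : a c * u c ((C.cluster c).pt f y) = 0 := h1.symm.trans h2
    exact (mul_eq_zero.1 h3).resolve_right hp
  have h := G.naturalEigenvalue_le T hT (fun a => C.isH1_glueFun (hH a)) (t := t) fun a => by
    change (G.form (C.glueFun fun c => a c • u c) (C.glueFun fun c => a c • u c)).re ≤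
      t * (G.innerL2 (C.glueFun fun c => a c • u c) (C.glueFun fun c => a c • u c)).re
    rw [C.form_glueFun (hH a), C.innerL2_glueFun (hH a), Complex.re_sum, Complex.re_sum,
      Finset.mul_sum]
    refine Finset.sum_le_sum fun c _ => ?_
    rw [form_smul, innerL2_smul, (hu c).2 _ (hu c).1, Complex.re_ofReal_mul, Complex.re_ofReal_mul,
      Complex.re_ofReal_mul, mul_left_comm t]
    exact mul_le_mul_of_nonneg_left (mul_le_mul_of_nonneg_right (hs c)
      (innerL2_self_re_nonneg _ _)) (by positivity)
  rwa [Module.finrank_fintype_fun_eq_card, ← Nat.card_eq_fintype_card] at h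

end

end MetricGraph

theorem mainTheorem4 {E : Type*} [Fintype E] (G : MetricGraph E) [PathConnectedSpace G.Points]
    (k : ℕ) (hk : 1 ≤ k) :
    G.naturalEigenvalue k ≤ G.dirichletMinimalEnergy k := by
  refine le_iInf₂ fun C hC => ?_
  obtain rfl := hC.1
  have : Finite C.Component := (Nat.card_pos_iff.1 hk).2
  exact MetricGraph.naturalEigenvalue_le_dirichletEnergy C
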